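/- Let $V$ and $W$ be finite-dimensional complex vector spaces, and write $\mathbb{C}[W\otimes V]=\bigoplus_{d\ge 0}S_d(W\otimes V)$ for the symmetric algebra of $W\otimes V$, graded by degree, on which $\operatorname{GL}(V)$ acts by graded algebra automorphisms through its natural action on the factor $V$. Let $R\subset\mathbb{C}[W\otimes V]$ be a $\operatorname{GL}(V)$-stable graded $\mathbb{C}$-subalgebra, $R=\bigoplus_{d\ge0}R_d$ with $R_d=R\cap S_d(W\otimes V)$. Let $\beta(R)$ be the smallest integer $N\ge 0$ such that the elements of $R$ of degree at most $N$ generate $R$ as a $\mathbb{C}$-algebra, with $\beta(R)=\infty$ if there is no such $N$. A representation of $\operatorname{GL}(V)$ is said to occur in $R_d$ if it is isomorphic to a subrepresentation of $R_d$. Let $t\ge 0$ be an integer and assume that 1. $\bigwedge^i(V)$ does not occur in $R_i$ for $i=1,2,\dots,t-1$; 2. $\bigwedge^t(V)$ occurs in $R_t$; 3. $\dim V\ge t$. Then $\beta(R)\ge t$. -/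

import Mathlib

open scoped TensorProduct

noncomputable section

namespace TensorInvariants

universe u v

/-! ### Symmetric algebras: grading and functoriality -/

section Sym

variable (U : Type u) [AddCommGroup U] [Module ℂ U]

/-- The degree `d` part `S_d(U)` of the symmetric algebra of `U`: the span of all products of
`d` elements of `U`. -/
def symPart (d : ℕ) : Submodule ℂ (SymmetricAlgebra ℂ U) :=
  LinearMap.range (SymmetricAlgebra.ι ℂ U) ^ d

variable {U}

/-- The algebra endomorphism of the symmetric algebra induced by a linear endomorphism of `U`. -/
def symMap (f : U →ₗ[ℂ] U) : SymmetricAlgebra ℂ U →ₐ[ℂ] SymmetricAlgebra ℂ U :=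
  SymmetricAlgebra.lift (SymmetricAlgebra.ι ℂ U ∘ₗ f)

theorem symMap_ι (f : U →ₗ[ℂ] U) (x : U) :
    symMap f (SymmetricAlgebra.ι ℂ U x) = SymmetricAlgebra.ι ℂ U (f x) := by
  simp [symMap]

theorem symMap_id : symMap (LinearMap.id : U →ₗ[ℂ] U) = AlgHom.id ℂ _ := by
  simp [symMap]

theorem symMap_comp (f g : U →ₗ[ℂ] U) : symMap (f ∘ₗ g) = (symMap f).comp (symMap g) := by
  apply SymmetricAlgebra.algHom_ext
  ext x
  simp [symMap]

theorem symMap_mem_symPart (f : U →ₗ[ℂ] U) (d : ℕ) {x : SymmetricAlgebra ℂ U}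
    (hx : x ∈ symPart U d) : symMap f x ∈ symPart U d := by
  have h : (symPart U d).map (symMap f).toLinearMap ≤ symPart U d := by
    unfold symPart
    rw [Submodule.map_pow]
    refine pow_le_pow_left' ?_ d
    rintro _ ⟨_, ⟨y, rfl⟩, rfl⟩
    exact ⟨f y, (symMap_ι f y).symm⟩
  exact h ⟨x, hx, rfl⟩

/-- A subalgebra `R` of the symmetric algebra is graded if it is the sum of its homogeneous
parts `R_d = R ∩ S_d(U)`. -/
def IsGraded (R : Subalgebra ℂ (SymmetricAlgebra ℂ U)) : Prop :=
  Subalgebra.toSubmodule R = ⨆ d : ℕ, Subalgebra.toSubmodule R ⊓ symPart U d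

/-- `R` is generated, as a `ℂ`-algebra, by its homogeneous elements of degree at most `N`. -/
def GeneratedInDegreeLE (R : Subalgebra ℂ (SymmetricAlgebra ℂ U)) (N : ℕ) : Prop :=
  Algebra.adjoin ℂ {f : SymmetricAlgebra ℂ U | f ∈ R ∧ ∃ d ≤ N, f ∈ symPart U d} = R

/-- `β(R)`: the smallest `N` such that the elements of `R` of degree at most `N` generate `R`;
it is `∞` if there is no such `N`. -/
def beta (R : Subalgebra ℂ (SymmetricAlgebra ℂ U)) : ℕ∞ :=
  ⨅ (N : ℕ) (_ : GeneratedInDegreeLE R N), (N : ℕ∞)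

end Sym

/-! ### The actions of `GL(V)` -/

section Action

variable (W : Type u) (V : Type v) [AddCommGroup W] [Module ℂ W] [AddCommGroup V] [Module ℂ V]

/-- The action of `GL(V)` on `ℂ[W ⊗ V] = ⨁_d S_d(W ⊗ V)` by algebra automorphisms, induced by its
action on the second tensor factor. -/
def polyRep : Representation ℂ (LinearMap.GeneralLinearGroup ℂ V)
    (SymmetricAlgebra ℂ (W ⊗[ℂ] V)) where
  toFun g := (symMap (LinearMap.lTensor W (g : V →ₗ[ℂ] V))).toLinearMap
  map_one' := by
    rw [Units.val_one, Module.End.one_eq_id, LinearMap.lTensor_id, symMap_id]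
    rfl
  map_mul' g h := by
    rw [Units.val_mul, Module.End.mul_eq_comp, LinearMap.lTensor_comp, symMap_comp]
    rfl

/-- The action of `GL(V)` on the exterior power `⋀^i V`. -/
def extRep (i : ℕ) : Representation ℂ (LinearMap.GeneralLinearGroup ℂ V) (⋀[ℂ]^i V) where
  toFun g := exteriorPower.map i (g : V →ₗ[ℂ] V)
  map_one' := by
    rw [Units.val_one, Module.End.one_eq_id, exteriorPower.map_id]
    rfl
  map_mul' g h := by
    rw [Units.val_mul, Module.End.mul_eq_comp, exteriorPower.map_comp]
    rfl

variable {W V}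

/-- `R` is stable under `GL(V)`. -/
def IsGLStable (R : Subalgebra ℂ (SymmetricAlgebra ℂ (W ⊗[ℂ] V))) : Prop :=
  ∀ g : LinearMap.GeneralLinearGroup ℂ V, ∀ f ∈ R, polyRep W V g f ∈ R

/-- The homogeneous part `R_d = R ∩ S_d(W ⊗ V)` of a `GL(V)`-stable `R`, as a
subrepresentation. -/
def gradedPiece {R : Subalgebra ℂ (SymmetricAlgebra ℂ (W ⊗[ℂ] V))} (hR : IsGLStable R) (d : ℕ) :
    Subrepresentation (polyRep W V) where
  toSubmodule := Subalgebra.toSubmodule R ⊓ symPart (W ⊗[ℂ] V) d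
  apply_mem_toSubmodule g _ hf := ⟨hR g _ hf.1, symMap_mem_symPart _ d hf.2⟩

end Action

/-- The representation `σ` occurs in `ρ`, i.e. `ρ` has a subrepresentation isomorphic to `σ`.
For `σ` irreducible and `ρ` a direct sum of irreducibles, this says that `σ` is one of the
summands, up to isomorphism. -/
def Occurs {G X Y : Type*} [Group G] [AddCommGroup X] [Module ℂ X] [AddCommGroup Y] [Module ℂ Y]
    (σ : Representation ℂ G X) (ρ : Representation ℂ G Y) : Prop :=
  ∃ f : Representation.IntertwiningMap σ ρ, Function.Injective f

end TensorInvariants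

end

noncomputable section

namespace TensorInvariants

/-! ### Eigenvectors and invariant subspaces -/

/-! Signs cancel in `⋀W ⊗ ⋀V`, so `w ⊗ v ↦ w ⊗ v` extends to an algebra homomorphism `toExt` from
the symmetric algebra. It detects copies of `⋀^d V` in a stable `R`. If `toExt` is nonzero somewhere
on `R_d`, then `⋀^d V` occurs in `R_d` (`occurs_of_toExt_ne_zero`). Conversely, on an embedded copy
of `⋀^d V` in degree `d`, a wedge of distinct basis vectors has image `ω ⊗ (e_1 ∧ ⋯ ∧ e_d)` with `ω
≠ 0` (`toExt_equivariant`).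

If `R` were generated in degrees at most `N < t`, all generators of positive degree would be killed,
so `toExt` would map `R` to scalars. The copy of `⋀^t V` in `R_t` contradicts this.

Both facts rest on `exists_antisymmetrization`, applied to vectors of multiplicity-free weight. A
single diagonal matrix with distinct prime entries isolates these weights by unique factorization.
-/

/-- Applying `T - c a` removes the `a`-term and rescales the others by nonzero factors, which allows
induction on `s`. -/
theorem mem_of_sum_eigenvectors_mem {K M : Type*} [Field K] [AddCommGroup M] [Module K M]
    (T : M →ₗ[K] M) (p : Submodule K M) (hp : ∀ x ∈ p, T x ∈ p) {ι : Type*}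
    {c : ι → K} (hc : Function.Injective c) (s : Finset ι) :
    ∀ g : ι → M, (∀ i ∈ s, T (g i) = c i • g i) → ∑ i ∈ s, g i ∈ p → ∀ i ∈ s, g i ∈ p := by
  classical
  induction s using Finset.induction_on with
  | empty => simp
  | insert a s ha ih =>
    intro g hg hsum
    have key : ∀ i ∈ s, (c i - c a) • g i ∈ p := by
      apply ih (fun i => (c i - c a) • g i)
      · intro i hi
        simp only [map_smul, hg i (Finset.mem_insert_of_mem hi)]
        rw [smul_comm]
      · have h := p.sub_mem (hp _ hsum) (p.smul_mem (c a) hsum)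
        rw [Finset.sum_insert ha, map_add, hg a (Finset.mem_insert_self a s), smul_add,
          add_sub_add_left_eq_sub, map_sum, Finset.smul_sum, ← Finset.sum_sub_distrib] at h
        convert h using 1
        refine Finset.sum_congr rfl fun i hi => ?_
        rw [hg i (Finset.mem_insert_of_mem hi), sub_smul]
    have hs : ∀ i ∈ s, g i ∈ p := by
      intro i hi
      have hne : c i - c a ≠ 0 := by
        rw [sub_ne_zero]
        intro h
        exact ha (hc h ▸ hi)
      exact (p.smul_mem_iff hne).1 (key i hi)
    intro i hi
    rcases Finset.mem_insert.1 hi with rfl | hi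
    · rw [Finset.sum_insert ha] at hsum
      exact (p.add_mem_iff_left (p.sum_mem hs)).1 hsum
    · exact hs i hi

/-! ### Products of primes -/

/-- The product of the primes whose indices are the values of `j`. -/
def primeProd {n d : ℕ} (j : Fin d → Fin n) : ℕ := ∏ k, Nat.nth Nat.Prime (j k)

/-- Each prime indexed by `j` divides the other product, hence is one of its factors. Injectivity of
`j` makes the resulting choice of positions a permutation. -/
theorem exists_perm_of_primeProd_eq {n d : ℕ} {j j' : Fin d → Fin n}
    (hj : Function.Injective j) (h : primeProd j' = primeProd j) :
    ∃ σ : Equiv.Perm (Fin d), ∀ k, j' (σ k) = j k := by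
  have H : ∀ k, ∃ k', j' k' = j k := by
    intro k
    have hd : Nat.nth Nat.Prime (j k) ∣ primeProd j' := by
      rw [h]
      exact Finset.dvd_prod_of_mem (fun k => Nat.nth Nat.Prime (j k)) (Finset.mem_univ k)
    obtain ⟨k', -, hk'⟩ := (Nat.prime_nth_prime (j k)).prime.exists_mem_finset_dvd hd
    refine ⟨k', ?_⟩
    have := (Nat.prime_dvd_prime_iff_eq (Nat.prime_nth_prime _) (Nat.prime_nth_prime _)).1 hk'
    exact Fin.ext (Nat.nth_injective Nat.infinite_setOfPred_prime this).symm
  choose τ hτ using H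
  have hinj : Function.Injective τ := fun a c hac => hj (by rw [← hτ, ← hτ, hac])
  exact ⟨Equiv.ofBijective τ (Finite.injective_iff_bijective.1 hinj), hτ⟩

section

variable {W : Type*} {V : Type*} [AddCommGroup W] [Module ℂ W] [AddCommGroup V] [Module ℂ V]

/-! ### Monomials -/

/-- The product `∏ k, w k ⊗ v k` in the symmetric algebra. -/
def mono {d : ℕ} (w : Fin d → W) (v : Fin d → V) : SymmetricAlgebra ℂ (W ⊗[ℂ] V) :=
  ∏ k, SymmetricAlgebra.ι ℂ (W ⊗[ℂ] V) (w k ⊗ₜ[ℂ] v k)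

/-- `mono` as a multilinear map in the vectors of `V`. -/
def monoRight {d : ℕ} (w : Fin d → W) :
    MultilinearMap ℂ (fun _ : Fin d => V) (SymmetricAlgebra ℂ (W ⊗[ℂ] V)) :=
  (MultilinearMap.mkPiAlgebra ℂ (Fin d) (SymmetricAlgebra ℂ (W ⊗[ℂ] V))).compLinearMap
    fun k => SymmetricAlgebra.ι ℂ (W ⊗[ℂ] V) ∘ₗ TensorProduct.mk ℂ W V (w k)

/-- `mono` as a multilinear map in the vectors of `W`. -/
def monoLeft {d : ℕ} (v : Fin d → V) :
    MultilinearMap ℂ (fun _ : Fin d => W) (SymmetricAlgebra ℂ (W ⊗[ℂ] V)) :=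
  (MultilinearMap.mkPiAlgebra ℂ (Fin d) (SymmetricAlgebra ℂ (W ⊗[ℂ] V))).compLinearMap
    fun k => SymmetricAlgebra.ι ℂ (W ⊗[ℂ] V) ∘ₗ (TensorProduct.mk ℂ W V).flip (v k)

theorem monoRight_apply {d : ℕ} (w : Fin d → W) (v : Fin d → V) : monoRight w v = mono w v := by
  simp [monoRight, mono]

theorem monoLeft_apply {d : ℕ} (w : Fin d → W) (v : Fin d → V) : monoLeft v w = mono w v := by
  simp [monoLeft, mono]

theorem mono_comp_perm {d : ℕ} (w : Fin d → W) (v : Fin d → V) (σ : Equiv.Perm (Fin d)) :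
    mono (fun k => w (σ k)) (fun k => v (σ k)) = mono w v :=
  Equiv.prod_comp σ fun k => SymmetricAlgebra.ι ℂ (W ⊗[ℂ] V) (w k ⊗ₜ[ℂ] v k)

theorem mono_mem_symPart {d : ℕ} (w : Fin d → W) (v : Fin d → V) :
    mono w v ∈ symPart (W ⊗[ℂ] V) d := by
  unfold mono symPart
  rw [← List.prod_ofFn]
  refine Submodule.pow_subset_pow _ ?_
  exact Set.mem_pow.2 ⟨fun k => ⟨_, LinearMap.mem_range_self _ (w k ⊗ₜ[ℂ] v k)⟩, rfl⟩

theorem polyRep_mono {d : ℕ} (g : LinearMap.GeneralLinearGroup ℂ V) (w : Fin d → W)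
    (v : Fin d → V) :
    polyRep W V g (mono w v) = mono w (fun k => (g : V →ₗ[ℂ] V) (v k)) := by
  change symMap (LinearMap.lTensor W (g : V →ₗ[ℂ] V)) (mono w v) = _
  simp [mono, map_prod, symMap_ι]

theorem symPart_le_span_mono {ι : Type*} (b : Module.Basis ι ℂ V) (d : ℕ) :
    symPart (W ⊗[ℂ] V) d ≤
      Submodule.span ℂ {x | ∃ (w : Fin d → W) (j : Fin d → ι), x = mono w (fun k => b (j k))} := by
  have h1 : LinearMap.range (SymmetricAlgebra.ι ℂ (W ⊗[ℂ] V)) ≤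
      Submodule.span ℂ
        {x | ∃ (w : W) (i : ι), x = SymmetricAlgebra.ι ℂ (W ⊗[ℂ] V) (w ⊗ₜ[ℂ] b i)} := by
    rintro _ ⟨x, rfl⟩
    induction x using TensorProduct.induction_on with
    | zero => simp
    | add x y hx hy => rw [map_add]; exact Submodule.add_mem _ hx hy
    | tmul w v =>
      induction b.mem_span v using Submodule.span_induction with
      | mem x hx =>
        obtain ⟨i, rfl⟩ := hx
        exact Submodule.subset_span ⟨w, i, rfl⟩
      | zero => simp
      | add x y _ _ hx hy =>
        rw [TensorProduct.tmul_add, map_add]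
        exact Submodule.add_mem _ hx hy
      | smul c x _ hx =>
        rw [TensorProduct.tmul_smul, map_smul]
        exact Submodule.smul_mem _ _ hx
  unfold symPart
  refine (pow_le_pow_left' h1 d).trans ?_
  rw [Submodule.span_pow]
  refine Submodule.span_mono fun x hx => ?_
  obtain ⟨f, rfl⟩ := Set.mem_pow.1 hx
  choose w j hwj using fun k => (f k).2
  refine ⟨w, j, ?_⟩
  simp only [List.prod_ofFn, mono, hwj]

/-! ### The map to the tensor product of exterior algebras -/

variable (W V) in
/-- The linear map `w ⊗ v ↦ w ⊗ v` from `W ⊗ V` to the tensor product of exterior algebras. -/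
def toExtLin : W ⊗[ℂ] V →ₗ[ℂ] ExteriorAlgebra ℂ W ⊗[ℂ] ExteriorAlgebra ℂ V :=
  TensorProduct.map (ExteriorAlgebra.ι ℂ) (ExteriorAlgebra.ι ℂ)

/-- Swapping two factors produces one sign in `⋀W` and one in `⋀V`, and these cancel. -/
theorem toExtLin_commute (x y : W ⊗[ℂ] V) :
    toExtLin W V x * toExtLin W V y = toExtLin W V y * toExtLin W V x := by
  induction x using TensorProduct.induction_on with
  | zero => simp
  | add x x' hx hx' => rw [map_add, add_mul, mul_add, hx, hx']
  | tmul w v =>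
    induction y using TensorProduct.induction_on with
    | zero => simp
    | add y y' hy hy' => rw [map_add, add_mul, mul_add, hy, hy']
    | tmul w' v' =>
      simp only [toExtLin, TensorProduct.map_tmul, Algebra.TensorProduct.tmul_mul_tmul]
      rw [eq_neg_of_add_eq_zero_left (ExteriorAlgebra.ι_add_mul_swap w w'),
        eq_neg_of_add_eq_zero_left (ExteriorAlgebra.ι_add_mul_swap v v'),
        TensorProduct.neg_tmul, TensorProduct.tmul_neg, neg_neg]

variable (W V) in
/-- The algebra homomorphism from the symmetric algebra of `W ⊗ V` to the tensor product of the
exterior algebras of `W` and `V` with `w ⊗ v ↦ w ⊗ v`. -/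
def toExt : SymmetricAlgebra ℂ (W ⊗[ℂ] V) →ₐ[ℂ] ExteriorAlgebra ℂ W ⊗[ℂ] ExteriorAlgebra ℂ V :=
  RingCon.liftₐ _ (TensorAlgebra.lift ℂ (toExtLin W V)) (by
    intro x y h
    refine RingCon.ringConGen_le (c := RingCon.ker
      (TensorAlgebra.lift ℂ (toExtLin W V)).toRingHom).2 (fun x y h' => ?_) h
    induction h' with | mul_comm x y
    rw [RingCon.ker_apply]
    simp [toExtLin_commute])

theorem toExt_ι (x : W ⊗[ℂ] V) :
    toExt W V (SymmetricAlgebra.ι ℂ (W ⊗[ℂ] V) x) = toExtLin W V x := by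
  rw [← TensorAlgebra.lift_ι_apply (R := ℂ) (toExtLin W V) x]
  rfl

theorem list_prod_tmul {A B : Type*} [Ring A] [Algebra ℂ A] [Ring B] [Algebra ℂ B] {d : ℕ} :
    ∀ (x : Fin d → A) (y : Fin d → B), (List.ofFn fun k => x k ⊗ₜ[ℂ] y k).prod =
      (List.ofFn x).prod ⊗ₜ[ℂ] (List.ofFn y).prod := by
  induction d with
  | zero => intro x y; simp [Algebra.TensorProduct.one_def]
  | succ d ih => intro x y; simp [List.ofFn_succ, ih]

theorem toExt_mono {d : ℕ} (w : Fin d → W) (v : Fin d → V) :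
    toExt W V (mono w v) = ExteriorAlgebra.ιMulti ℂ d w ⊗ₜ[ℂ] ExteriorAlgebra.ιMulti ℂ d v := by
  rw [mono, ← List.prod_ofFn, map_list_prod, List.map_ofFn, ExteriorAlgebra.ιMulti_apply,
    ExteriorAlgebra.ιMulti_apply, ← list_prod_tmul]
  congr 2
  ext k
  simp [toExt_ι, toExtLin]

/-! ### Weight spaces of a diagonal matrix with prime eigenvalues -/

/-- The span of the monomials `∏ k, w k ⊗ b (j k)` with `primeProd j = m`. -/
def weightSpan (W : Type*) [AddCommGroup W] [Module ℂ W] {n : ℕ} (b : Module.Basis (Fin n) ℂ V)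
    (d m : ℕ) : Submodule ℂ (SymmetricAlgebra ℂ (W ⊗[ℂ] V)) :=
  Submodule.span ℂ
    {x | ∃ (w : Fin d → W) (j : Fin d → Fin n), primeProd j = m ∧ x = mono w (fun k => b (j k))}

theorem exists_weight_decomposition {n : ℕ} (b : Module.Basis (Fin n) ℂ V) {d : ℕ}
    {f : SymmetricAlgebra ℂ (W ⊗[ℂ] V)} (hf : f ∈ symPart (W ⊗[ℂ] V) d) :
    ∃ (s : Finset ℕ) (g : ℕ → SymmetricAlgebra ℂ (W ⊗[ℂ] V)),
      (∀ m, g m ∈ weightSpan W b d m) ∧ f = ∑ m ∈ s, g m := by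
  have h : f ∈ ⨆ m, weightSpan W b d m := by
    refine Submodule.span_le.2 ?_ (symPart_le_span_mono b d hf)
    rintro _ ⟨w, j, rfl⟩
    exact Submodule.mem_iSup_of_mem (primeProd j) (Submodule.subset_span ⟨w, j, rfl, rfl⟩)
  obtain ⟨g, hg, rfl⟩ := (Submodule.mem_iSup_iff_exists_finsupp _ _).1 h
  exact ⟨g.support, g, hg, rfl⟩

/-- The diagonal matrix whose `i`-th entry is the `i`-th prime. -/
def primeDiag {n : ℕ} (b : Module.Basis (Fin n) ℂ V) : LinearMap.GeneralLinearGroup ℂ V :=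
  LinearMap.GeneralLinearGroup.ofLinearEquiv
    (b.equiv (b.unitsSMul fun i => Units.mk0 (Nat.nth Nat.Prime i : ℂ)
      (Nat.cast_ne_zero.2 (Nat.prime_nth_prime i).ne_zero)) (Equiv.refl _))

theorem primeDiag_apply {n : ℕ} (b : Module.Basis (Fin n) ℂ V) (i : Fin n) :
    (primeDiag b : V →ₗ[ℂ] V) (b i) = (Nat.nth Nat.Prime i : ℂ) • b i := by
  change b.equiv _ _ (b i) = _
  rw [Module.Basis.equiv_apply]
  simp [Module.Basis.unitsSMul_apply, Units.smul_def]

theorem polyRep_primeDiag {n : ℕ} (b : Module.Basis (Fin n) ℂ V) {d m : ℕ}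
    {f : SymmetricAlgebra ℂ (W ⊗[ℂ] V)} (hf : f ∈ weightSpan W b d m) :
    polyRep W V (primeDiag b) f = (m : ℂ) • f := by
  induction hf using Submodule.span_induction with
  | mem x hx =>
    obtain ⟨w, j, rfl, rfl⟩ := hx
    rw [polyRep_mono]
    simp only [primeDiag_apply]
    rw [← monoRight_apply, MultilinearMap.map_smul_univ, monoRight_apply, primeProd, Nat.cast_prod]
  | zero => simp
  | add x y _ _ hx hy => rw [map_add, hx, hy, smul_add]
  | smul c x _ hx => rw [map_smul, hx, smul_comm]

theorem weightSpan_le_span {n : ℕ} (b : Module.Basis (Fin n) ℂ V) {d : ℕ} {j : Fin d → Fin n}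
    (hj : Function.Injective j) :
    weightSpan W b d (primeProd j) ≤
      Submodule.span ℂ (Set.range fun w : Fin d → W => mono w (fun k => b (j k))) := by
  refine Submodule.span_le.2 ?_
  rintro _ ⟨w, j', h, rfl⟩
  obtain ⟨σ, hσ⟩ := exists_perm_of_primeProd_eq hj h
  refine Submodule.subset_span ⟨fun k => w (σ k), ?_⟩
  simp only [← hσ]
  exact mono_comp_perm w (fun k => b (j' k)) σ

theorem weightComponent_mem {n : ℕ} (b : Module.Basis (Fin n) ℂ V) {d : ℕ}
    (p : Submodule ℂ (SymmetricAlgebra ℂ (W ⊗[ℂ] V)))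
    (hp : ∀ x ∈ p, polyRep W V (primeDiag b) x ∈ p) {s : Finset ℕ}
    {g : ℕ → SymmetricAlgebra ℂ (W ⊗[ℂ] V)} (hg : ∀ m, g m ∈ weightSpan W b d m)
    (hs : ∑ m ∈ s, g m ∈ p) : ∀ m ∈ s, g m ∈ p :=
  mem_of_sum_eigenvectors_mem (polyRep W V (primeDiag b)) p hp (Nat.cast_injective (R := ℂ)) s g
    (fun m _ => polyRep_primeDiag b (hg m)) hs

/-- An element on which the torus acts with a multiplicity free weight is a combination of
monomials of that weight. -/
theorem mem_span_of_polyRep_primeDiag {n : ℕ} (b : Module.Basis (Fin n) ℂ V) {d : ℕ}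
    {j : Fin d → Fin n} (hj : Function.Injective j) {f : SymmetricAlgebra ℂ (W ⊗[ℂ] V)}
    (hf : f ∈ symPart (W ⊗[ℂ] V) d)
    (hT : polyRep W V (primeDiag b) f = (primeProd j : ℂ) • f) :
    f ∈ Submodule.span ℂ (Set.range fun w : Fin d → W => mono w (fun k => b (j k))) := by
  obtain ⟨s, g, hg, rfl⟩ := exists_weight_decomposition b hf
  -- The eigenspace of `primeProd j` is stable, so it contains every weight component of `f`.
  -- Components with another eigenvalue must therefore vanish.
  have H := weightComponent_mem b
    (LinearMap.ker (polyRep W V (primeDiag b) - (primeProd j : ℂ) • LinearMap.id))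
    (fun x hx => by
      rw [LinearMap.mem_ker, LinearMap.sub_apply, LinearMap.smul_apply, LinearMap.id_apply,
        sub_eq_zero] at hx ⊢
      rw [hx, map_smul, hx]) hg
    (by rw [LinearMap.mem_ker, LinearMap.sub_apply, hT, LinearMap.smul_apply,
      LinearMap.id_apply, sub_self])
  refine Submodule.sum_mem _ fun m hm => ?_
  have h := H m hm
  rw [LinearMap.mem_ker, LinearMap.sub_apply, polyRep_primeDiag b (hg m), LinearMap.smul_apply,
    LinearMap.id_apply, ← sub_smul, smul_eq_zero, sub_eq_zero, Nat.cast_inj] at h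
  rcases h with rfl | h
  · exact weightSpan_le_span b hj (hg _)
  · rw [h]; exact Submodule.zero_mem _

/-- A stable submodule of degree `d` not killed by `toExt` contains a multilinear element not
killed by `toExt`. -/
theorem exists_multilinear_mem {n : ℕ} (b : Module.Basis (Fin n) ℂ V) {d : ℕ}
    (p : Submodule ℂ (SymmetricAlgebra ℂ (W ⊗[ℂ] V)))
    (hp : ∀ x ∈ p, polyRep W V (primeDiag b) x ∈ p) {f : SymmetricAlgebra ℂ (W ⊗[ℂ] V)}
    (hfp : f ∈ p) (hf : f ∈ symPart (W ⊗[ℂ] V) d) (hne : toExt W V f ≠ 0) :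
    ∃ j : Fin d → Fin n, Function.Injective j ∧ ∃ m ∈ p, toExt W V m ≠ 0 ∧
      m ∈ Submodule.span ℂ (Set.range fun w : Fin d → W => mono w (fun k => b (j k))) := by
  obtain ⟨s, g, hg, rfl⟩ := exists_weight_decomposition b hf
  rw [map_sum] at hne
  obtain ⟨m, hm, hmne⟩ := Finset.exists_ne_zero_of_sum_ne_zero hne
  have hinj : ∃ j : Fin d → Fin n, Function.Injective j ∧ primeProd j = m := by
    by_contra! hcon
    refine hmne ?_
    have hle : weightSpan W b d m ≤ LinearMap.ker (toExt W V).toLinearMap := by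
      refine Submodule.span_le.2 ?_
      rintro _ ⟨w, j, h, rfl⟩
      -- A repeated basis vector makes the wedge in `⋀V` zero, so only injective `j` survive
      -- `toExt`.
      have hj : ¬ Function.Injective fun k => b (j k) := fun hj =>
        hcon j (fun x y hxy => hj (by simp only [hxy])) h
      rw [SetLike.mem_coe, LinearMap.mem_ker, AlgHom.toLinearMap_apply, toExt_mono,
        AlternatingMap.map_eq_zero_of_not_injective _ _ hj, TensorProduct.tmul_zero]
    exact hle (hg m)
  obtain ⟨j, hj, rfl⟩ := hinj
  exact ⟨j, hj, _, weightComponent_mem b p hp hg hfp _ hm, hmne, weightSpan_le_span b hj (hg _)⟩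

/-! ### Permutation matrices and exterior powers -/

theorem exists_gl_map_eq {n d : ℕ} (b : Module.Basis (Fin n) ℂ V) {j j' : Fin d → Fin n}
    (hj : Function.Injective j) (hj' : Function.Injective j') :
    ∃ g : LinearMap.GeneralLinearGroup ℂ V, ∀ k, (g : V →ₗ[ℂ] V) (b (j k)) = b (j' k) := by
  let e := (Equiv.ofInjective j hj).symm.trans (Equiv.ofInjective j' hj')
  refine ⟨LinearMap.GeneralLinearGroup.ofLinearEquiv (b.equiv b e.extendSubtype), fun k => ?_⟩
  change b.equiv b _ (b (j k)) = _
  rw [Module.Basis.equiv_apply, Equiv.extendSubtype_apply_of_mem e (j k) ⟨k, rfl⟩]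
  simp [e, Equiv.ofInjective_symm_apply]

theorem extRep_ιMulti (d : ℕ) (g : LinearMap.GeneralLinearGroup ℂ V) (v : Fin d → V) :
    extRep V d g (exteriorPower.ιMulti ℂ d v) =
      exteriorPower.ιMulti ℂ d (fun k => (g : V →ₗ[ℂ] V) (v k)) :=
  exteriorPower.map_apply_ιMulti _ _

/-- Permutation matrices carry one wedge of distinct basis vectors to all the others, and these span
`⋀^d V`. -/
theorem eq_top_of_ιMulti_mem {n d : ℕ} (b : Module.Basis (Fin n) ℂ V) {j : Fin d → Fin n}
    (hj : Function.Injective j) (p : Submodule ℂ (⋀[ℂ]^d V))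
    (hp : ∀ g : LinearMap.GeneralLinearGroup ℂ V, ∀ x ∈ p, extRep V d g x ∈ p)
    (hmem : exteriorPower.ιMulti ℂ d (fun k => b (j k)) ∈ p) : p = ⊤ := by
  have h : p.mkQ = 0 := by
    apply exteriorPower.linearMap_ext
    refine Module.Basis.ext_alternating b fun j' hj' => ?_
    obtain ⟨g, hg⟩ := exists_gl_map_eq b hj hj'
    have := hp g _ hmem
    rw [extRep_ιMulti] at this
    simp only [hg] at this
    simpa using this
  rw [← p.ker_mkQ, h, LinearMap.ker_zero]

/-- Pairing with the wedge of the dual coordinates gives the determinant of the identity matrix. -/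
theorem ιMulti_basis_ne_zero {n d : ℕ} (b : Module.Basis (Fin n) ℂ V) {j : Fin d → Fin n}
    (hj : Function.Injective j) : exteriorPower.ιMulti ℂ d (fun k => b (j k)) ≠ 0 := by
  intro h
  have h1 := exteriorPower.pairingDual_ιMulti_ιMulti (R := ℂ) (n := d) (fun k => b.coord (j k))
    (fun k => b (j k))
  have h2 : (Matrix.of fun i k => b.coord (j k) (b (j i))) = (1 : Matrix (Fin d) (Fin d) ℂ) := by
    ext i k
    simp [Matrix.one_apply, Finsupp.single_apply, hj.eq_iff]
  rw [h, h2, map_zero, Matrix.det_one] at h1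
  exact zero_ne_one h1

/-! ### Antisymmetrization -/

/-- For `m = mono w e`, antisymmetrizing over the vectors of `V` gives `G`, and `ω` is the wedge of
`w`; everything extends linearly in `m`. The formula for `toExt (G x)` makes `G` injective when `ω ≠
0`. The expression of the antisymmetrization through `ω` alone shows that it vanishes when `ω = 0`.
-/
theorem exists_antisymmetrization {d : ℕ} (e : Fin d → V)
    (P : Equiv.Perm (Fin d) → LinearMap.GeneralLinearGroup ℂ V)
    (hP : ∀ σ k, (P σ : V →ₗ[ℂ] V) (e k) = e (σ k)) {m : SymmetricAlgebra ℂ (W ⊗[ℂ] V)}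
    (hm : m ∈ Submodule.span ℂ (Set.range fun w : Fin d → W => mono w e)) :
    ∃ (ω : ⋀[ℂ]^d W) (G : ⋀[ℂ]^d V →ₗ[ℂ] SymmetricAlgebra ℂ (W ⊗[ℂ] V)),
      (∀ g x, G (extRep V d g x) = polyRep W V g (G x)) ∧
      (∀ x, G x ∈ symPart (W ⊗[ℂ] V) d) ∧
      G (exteriorPower.ιMulti ℂ d e) =
        ∑ σ : Equiv.Perm (Fin d), Equiv.Perm.sign σ • polyRep W V (P σ) m ∧
      exteriorPower.alternatingMapLinearEquiv (monoLeft e).alternatization ω =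
        ∑ σ : Equiv.Perm (Fin d), Equiv.Perm.sign σ • polyRep W V (P σ) m ∧
      toExt W V m = (ω : ExteriorAlgebra ℂ W) ⊗ₜ[ℂ] ExteriorAlgebra.ιMulti ℂ d e ∧
      ∀ x : ⋀[ℂ]^d V, toExt W V (G x) =
        (d.factorial : ℂ) • ((ω : ExteriorAlgebra ℂ W) ⊗ₜ[ℂ] (x : ExteriorAlgebra ℂ V)) := by
  induction hm using Submodule.span_induction with
  | mem x hx =>
    obtain ⟨w, rfl⟩ := hx
    have hG : ∀ v : Fin d → V, exteriorPower.alternatingMapLinearEquiv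
        (monoRight w).alternatization (exteriorPower.ιMulti ℂ d v) =
          ∑ σ : Equiv.Perm (Fin d), Equiv.Perm.sign σ • mono w (fun k => v (σ k)) := by
      intro v
      rw [exteriorPower.alternatingMapLinearEquiv_apply_ιMulti,
        MultilinearMap.alternatization_apply]
      simp only [MultilinearMap.domDomCongr_apply, monoRight_apply]
    refine ⟨exteriorPower.ιMulti ℂ d w,
      exteriorPower.alternatingMapLinearEquiv (monoRight w).alternatization, ?_, ?_, ?_, ?_, ?_, ?_⟩
    · intro g x
      rw [← LinearMap.comp_apply, ← LinearMap.comp_apply]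
      congr 1
      apply exteriorPower.linearMap_ext
      ext v
      simp only [LinearMap.compAlternatingMap_apply, LinearMap.comp_apply, extRep_ιMulti, hG,
        map_sum, map_zsmul_unit, polyRep_mono]
    · intro x
      have : x ∈ Submodule.comap (exteriorPower.alternatingMapLinearEquiv
          (monoRight w).alternatization) (symPart (W ⊗[ℂ] V) d) := by
        have htop : x ∈ (⊤ : Submodule ℂ (⋀[ℂ]^d V)) := trivial
        rw [← exteriorPower.ιMulti_span] at htop
        refine Submodule.span_le.2 ?_ htop
        rintro _ ⟨v, rfl⟩
        rw [SetLike.mem_coe, Submodule.mem_comap, hG]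
        refine Submodule.sum_mem _ fun σ _ => ?_
        rw [Units.smul_def]
        exact zsmul_mem (mono_mem_symPart _ _) _
      exact this
    · rw [hG]
      simp only [polyRep_mono, hP]
    · rw [exteriorPower.alternatingMapLinearEquiv_apply_ιMulti,
        MultilinearMap.alternatization_apply]
      simp only [MultilinearMap.domDomCongr_apply, monoLeft_apply, polyRep_mono, hP]
      -- The factors of a monomial commute, so permuting the `V`-entries by `σ` amounts to permuting
      -- the `W`-entries by `σ⁻¹`, with the same sign.
      refine Fintype.sum_equiv (Equiv.inv _) _ _ fun σ => ?_
      rw [Equiv.inv_apply, Equiv.Perm.sign_inv, ← mono_comp_perm w (fun k => e (σ⁻¹ k)) σ]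
      simp
    · rw [toExt_mono]; rfl
    · intro x
      have : (toExt W V).toLinearMap ∘ₗ exteriorPower.alternatingMapLinearEquiv
          (monoRight w).alternatization = (d.factorial : ℂ) • (TensorProduct.mk ℂ _ _
            (ExteriorAlgebra.ιMulti ℂ d w) ∘ₗ (⋀[ℂ]^d V).subtype) := by
        apply exteriorPower.linearMap_ext
        ext v
        simp only [LinearMap.compAlternatingMap_apply, LinearMap.comp_apply, hG, map_sum,
          map_zsmul_unit, AlgHom.toLinearMap_apply, toExt_mono, LinearMap.smul_apply,
          TensorProduct.mk_apply, Submodule.subtype_apply, exteriorPower.ιMulti_apply_coe]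
        -- The sign of `σ` cancels the sign from reordering the wedge, so the `d!` summands are
        -- equal.
        rw [Finset.sum_congr rfl fun σ _ => ?_, Finset.sum_const, Finset.card_univ,
          Fintype.card_perm, Fintype.card_fin, Nat.cast_smul_eq_nsmul]
        rw [show (fun k => v (σ k)) = v ∘ σ from rfl, AlternatingMap.map_perm, Units.smul_def,
          Units.smul_def, TensorProduct.tmul_smul, smul_smul, Int.units_coe_mul_self, one_smul]
      exact LinearMap.congr_fun this x
  | zero =>
    exact ⟨0, 0, by simp, by simp, by simp, by simp, by simp, by simp⟩
  | add m₁ m₂ _ _ h₁ h₂ =>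
    obtain ⟨ω₁, G₁, a₁, b₁, c₁, d₁, e₁, f₁⟩ := h₁
    obtain ⟨ω₂, G₂, a₂, b₂, c₂, d₂, e₂, f₂⟩ := h₂
    refine ⟨ω₁ + ω₂, G₁ + G₂, ?_, ?_, ?_, ?_, ?_, ?_⟩
    · intro g x
      simp only [LinearMap.add_apply, a₁, a₂, map_add]
    · exact fun x => Submodule.add_mem _ (b₁ x) (b₂ x)
    · simp only [LinearMap.add_apply, c₁, c₂, map_add, smul_add, Finset.sum_add_distrib]
    · simp only [d₁, d₂, map_add, smul_add, Finset.sum_add_distrib]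
    · simp only [map_add, e₁, e₂, Submodule.coe_add, TensorProduct.add_tmul]
    · intro x
      simp only [LinearMap.add_apply, map_add, f₁, f₂, Submodule.coe_add, TensorProduct.add_tmul,
        smul_add]
  | smul c m _ h =>
    obtain ⟨ω, G, h₁, h₂, h₃, h₄, h₅, h₆⟩ := h
    refine ⟨c • ω, c • G, ?_, ?_, ?_, ?_, ?_, ?_⟩
    · intro g x
      simp only [LinearMap.smul_apply, h₁, map_smul]
    · exact fun x => Submodule.smul_mem _ c (h₂ x)
    · simp only [LinearMap.smul_apply, h₃, map_smul, Finset.smul_sum]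
      exact Finset.sum_congr rfl fun σ _ => smul_comm _ _ _
    · simp only [map_smul, h₄, Finset.smul_sum]
      exact Finset.sum_congr rfl fun σ _ => smul_comm _ _ _
    · simp only [map_smul, h₅, Submodule.coe_smul, TensorProduct.smul_tmul']
    · intro x
      simp only [LinearMap.smul_apply, map_smul, h₆, Submodule.coe_smul,
        ← TensorProduct.smul_tmul']
      exact smul_comm _ _ _

/-! ### Detecting `⋀^d V` by `toExt` -/

theorem tmul_eq_zero_iff_of_field {K A B : Type*} [Field K] [AddCommGroup A] [Module K A]
    [AddCommGroup B] [Module K B] {x : A} {y : B} : x ⊗ₜ[K] y = 0 ↔ x = 0 ∨ y = 0 := by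
  constructor
  · intro h
    by_contra! hxy
    obtain ⟨φ, hφ⟩ := not_forall.1 fun h' => hxy.1 ((Module.forall_dual_apply_eq_zero_iff K x).1 h')
    have h2 := congrArg ((TensorProduct.lid K B).toLinearMap ∘ₗ φ.rTensor B) h
    simp only [LinearMap.comp_apply, LinearMap.rTensor_tmul, LinearEquiv.coe_coe,
      TensorProduct.lid_tmul, map_zero, smul_eq_zero] at h2
    exact h2.elim hφ hxy.2
  · rintro (rfl | rfl)
    · exact TensorProduct.zero_tmul _ _
    · exact TensorProduct.tmul_zero _ _


theorem exists_perm_matrices {n d : ℕ} (b : Module.Basis (Fin n) ℂ V) {j : Fin d → Fin n}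
    (hj : Function.Injective j) :
    ∃ P : Equiv.Perm (Fin d) → LinearMap.GeneralLinearGroup ℂ V,
      ∀ σ k, (P σ : V →ₗ[ℂ] V) (b (j k)) = b (j (σ k)) := by
  choose P hP using fun σ : Equiv.Perm (Fin d) =>
    exists_gl_map_eq b hj (j' := fun k => j (σ k)) (hj.comp σ.injective)
  exact ⟨P, hP⟩

/-- If `toExt` does not vanish on `R_d`, then `⋀^d V` occurs in `R_d`. -/
theorem occurs_of_toExt_ne_zero [FiniteDimensional ℂ V]
    {R : Subalgebra ℂ (SymmetricAlgebra ℂ (W ⊗[ℂ] V))} (hR : IsGLStable R) {d : ℕ}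
    {f : SymmetricAlgebra ℂ (W ⊗[ℂ] V)} (hfR : f ∈ R) (hf : f ∈ symPart (W ⊗[ℂ] V) d)
    (hne : toExt W V f ≠ 0) :
    Occurs (extRep V d) (gradedPiece hR d).toRepresentation := by
  have b := Module.finBasis ℂ V
  obtain ⟨j, hj, m, hmR, hmne, hm⟩ :=
    exists_multilinear_mem b (Subalgebra.toSubmodule R) (fun x hx => hR _ x hx) hfR hf hne
  obtain ⟨P, hP⟩ := exists_perm_matrices b hj
  obtain ⟨ω, G, hG, hGd, hGe, -, hmω, hGω⟩ := exists_antisymmetrization _ P hP hm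
  have hω : (ω : ExteriorAlgebra ℂ W) ≠ 0 := by
    intro h
    rw [hmω, h, TensorProduct.zero_tmul] at hmne
    exact hmne rfl
  have hGR : ∀ x, G x ∈ R := by
    -- The preimage of `R` under `G` is stable and contains one basis wedge, whose image is a signed
    -- sum of translates of `m ∈ R`.
    have htop : (Subalgebra.toSubmodule R).comap G = ⊤ := by
      refine eq_top_of_ιMulti_mem b hj _ (fun g x hx => ?_) ?_
      · rw [Submodule.mem_comap, hG]
        exact hR g _ hx
      · rw [Submodule.mem_comap, hGe]
        refine Submodule.sum_mem _ fun σ _ => ?_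
        rw [Units.smul_def]
        exact zsmul_mem (hR _ _ hmR) _
    intro x
    have hx : x ∈ (Subalgebra.toSubmodule R).comap G := htop ▸ Submodule.mem_top
    exact hx
  refine ⟨⟨G.codRestrict _ fun x => ⟨hGR x, hGd x⟩, fun g => ?_⟩, ?_⟩
  · ext x
    exact congrArg _ (Subtype.ext (hG g _))
  · refine (injective_iff_map_eq_zero _).2 fun x hx => ?_
    have hx0 : G x = 0 := congrArg Subtype.val hx
    have h := hGω x
    rw [hx0, map_zero, eq_comm, smul_eq_zero] at h
    have h' := h.resolve_left (Nat.cast_ne_zero.2 d.factorial_ne_zero)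
    exact Subtype.ext ((tmul_eq_zero_iff_of_field.1 h').resolve_left hω)

/-- The image of a nonzero vector `e_1 ∧ ⋯ ∧ e_d` under an equivariant map from `⋀^d V` to
`S_d(W ⊗ V)` is of the form `ω ⊗ (e_1 ∧ ⋯ ∧ e_d)` with `ω ≠ 0` after applying `toExt`. -/
theorem toExt_equivariant {n d : ℕ} (b : Module.Basis (Fin n) ℂ V) {j : Fin d → Fin n}
    (hj : Function.Injective j) (F : ⋀[ℂ]^d V →ₗ[ℂ] SymmetricAlgebra ℂ (W ⊗[ℂ] V))
    (hF : ∀ g x, F (extRep V d g x) = polyRep W V g (F x))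
    (hFd : ∀ x, F x ∈ symPart (W ⊗[ℂ] V) d)
    (hne : F (exteriorPower.ιMulti ℂ d fun k => b (j k)) ≠ 0) :
    ∃ ω : ⋀[ℂ]^d W, (ω : ExteriorAlgebra ℂ W) ≠ 0 ∧
      toExt W V (F (exteriorPower.ιMulti ℂ d fun k => b (j k))) =
        (ω : ExteriorAlgebra ℂ W) ⊗ₜ[ℂ] ExteriorAlgebra.ιMulti ℂ d fun k => b (j k) := by
  obtain ⟨P, hP⟩ := exists_perm_matrices b hj
  have hT : polyRep W V (primeDiag b) (F (exteriorPower.ιMulti ℂ d fun k => b (j k))) =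
      (primeProd j : ℂ) • F (exteriorPower.ιMulti ℂ d fun k => b (j k)) := by
    rw [← hF, extRep_ιMulti]
    simp only [primeDiag_apply]
    rw [AlternatingMap.map_smul_univ, map_smul, primeProd, Nat.cast_prod]
  obtain ⟨ω, -, -, -, -, hω, hmω, -⟩ := exists_antisymmetrization _ P hP
    (mem_span_of_polyRep_primeDiag b hj (hFd _) hT)
  refine ⟨ω, fun h => hne ?_, hmω⟩
  have hω0 : ω = 0 := Subtype.ext h
  -- The vector is already alternating under the `P σ`, so its antisymmetrization is `d!` times
  -- itself; `ω = 0` would force it to vanish.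
  rw [hω0, map_zero, Finset.sum_congr rfl fun σ _ => ?_, Finset.sum_const, Finset.card_univ,
    Fintype.card_perm, Fintype.card_fin, ← Nat.cast_smul_eq_nsmul ℂ, eq_comm, smul_eq_zero] at hω
  · exact hω.resolve_left (Nat.cast_ne_zero.2 d.factorial_ne_zero)
  · rw [← hF, extRep_ιMulti]
    simp only [hP]
    rw [show (fun k => b (j (σ k))) = (fun k => b (j k)) ∘ σ from rfl, AlternatingMap.map_perm,
      map_zsmul_unit, smul_smul, Int.units_mul_self, one_smul]

theorem algebraMapInv_ιMulti {d : ℕ} (hd : d ≠ 0) (v : Fin d → V) :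
    ExteriorAlgebra.algebraMapInv (ExteriorAlgebra.ιMulti ℂ d v) = 0 := by
  obtain ⟨d, rfl⟩ := Nat.exists_eq_succ_of_ne_zero hd
  simp [ExteriorAlgebra.ιMulti_succ_apply, ExteriorAlgebra.algebraMapInv]

end

end TensorInvariants

end

/-! ### The degree bound -/

theorem mainTheorem8 {W : Type*} {V : Type*}
    [AddCommGroup W] [Module ℂ W] [FiniteDimensional ℂ W]
    [AddCommGroup V] [Module ℂ V] [FiniteDimensional ℂ V]
    (R : Subalgebra ℂ (SymmetricAlgebra ℂ (TensorProduct ℂ W V)))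
    (hgraded : TensorInvariants.IsGraded R)
    (hstable : TensorInvariants.IsGLStable R)
    (t : ℕ)
    (hlow : ∀ i : ℕ, 1 ≤ i → i < t →
      ¬ TensorInvariants.Occurs (TensorInvariants.extRep V i)
        (TensorInvariants.gradedPiece hstable i).toRepresentation)
    (htop : TensorInvariants.Occurs (TensorInvariants.extRep V t)
      (TensorInvariants.gradedPiece hstable t).toRepresentation)
    (hdim : t ≤ Module.finrank ℂ V) :
    (t : ℕ∞) ≤ TensorInvariants.beta R := by
  refine le_iInf₂ fun N hN => ?_
  by_contra hlt
  rw [not_le, Nat.cast_lt] at hlt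
  -- `toExt` maps `R` to the scalars
  have hscalar : R ≤ (⊥ : Subalgebra ℂ _).comap (TensorInvariants.toExt W V) := by
    rw [← hN]
    refine Algebra.adjoin_le ?_
    rintro f ⟨hfR, d, hd, hf⟩
    rcases Nat.eq_zero_or_pos d with rfl | hpos
    · rw [TensorInvariants.symPart, pow_zero] at hf
      obtain ⟨c, rfl⟩ := Submodule.mem_one.1 hf
      exact Subalgebra.algebraMap_mem _ c
    · have h0 : TensorInvariants.toExt W V f = 0 := by
        by_contra hne
        exact hlow d hpos (hd.trans_lt hlt)
          (TensorInvariants.occurs_of_toExt_ne_zero hstable hfR hf hne)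
      change TensorInvariants.toExt W V f ∈ (⊥ : Subalgebra ℂ _)
      rw [h0]
      exact Subalgebra.zero_mem _
  obtain ⟨F, hF⟩ := htop
  let b := Module.finBasis ℂ V
  have hj : Function.Injective (Fin.castLE hdim) := Fin.castLE_injective hdim
  obtain ⟨ω, hω, hFω⟩ := TensorInvariants.toExt_equivariant b hj
    ((TensorInvariants.gradedPiece hstable t).toSubmodule.subtype ∘ₗ F.toLinearMap)
    (fun g x => congrArg Subtype.val (F.isIntertwining _ _ g x)) (fun x => (F x).2.2)
    (fun h => TensorInvariants.ιMulti_basis_ne_zero b hj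
      (hF ((Subtype.ext h).trans (map_zero F.toLinearMap).symm)))
  obtain ⟨c, hc⟩ := Algebra.mem_bot.1 (hscalar (F (exteriorPower.ιMulti ℂ t
    fun k => b (Fin.castLE hdim k))).2.1)
  have heq := hc.trans hFω
  -- Projecting `⋀V` to degree `0` kills the wedge, since `N < t` gives `t ≠ 0`, but fixes the
  -- scalar. Hence the scalar is zero, and so is `ω ⊗ (e_1 ∧ ⋯ ∧ e_t)`.
  have hε := congrArg (LinearMap.lTensor (ExteriorAlgebra ℂ W)
    (ExteriorAlgebra.algebraMapInv (R := ℂ) (M := V)).toLinearMap) heq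
  rw [Algebra.TensorProduct.algebraMap_apply, LinearMap.lTensor_tmul, LinearMap.lTensor_tmul,
    AlgHom.toLinearMap_apply, AlgHom.toLinearMap_apply, map_one,
    TensorInvariants.algebraMapInv_ιMulti (by omega), TensorProduct.tmul_zero,
    TensorInvariants.tmul_eq_zero_iff_of_field] at hε
  have hc0 := hε.resolve_right one_ne_zero
  rw [Algebra.TensorProduct.algebraMap_apply, hc0, TensorProduct.zero_tmul, eq_comm,
    TensorInvariants.tmul_eq_zero_iff_of_field] at heq
  exact TensorInvariants.ιMulti_basis_ne_zero b hj (Subtype.ext (heq.resolve_left hω))
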